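/- Let $a$ be a nonzero integer. Let $C_a$ be the smooth projective genus $3$ hyperelliptic curve over $\mathbb{Q}$ given by $$y^2 = x^8 + (4-4a^4)x^6 + (8a^4+6)x^4 + (4-4a^4)x^2 + 1,$$ with homogeneous coordinates $[x:y:z]$ of weights $1,4,1$ (so $C_a$ has two points $[1:\pm1:0]$ at infinity), and let $E_a$ be the elliptic curve $y^2 = x^3 + 2a^2x^2 + (a^4-4)x$ over $\mathbb{Q}$. Let $\varphi_1,\varphi_2\colon C_a\to E_a$ be the maps $$\begin{aligned} \varphi_1 = [\,&-a^2x^6+5a^2x^4z^2-2x^2y+5a^2x^2z^4-2yz^2-a^2z^6 :\\ & 4a^3x^5z-24a^3x^3z^3+8axyz+4a^3xz^5 : (x^2+z^2)^3\,],\\ \varphi_2 = [\,& a^2x^6-5a^2x^4z^2-2x^2y-5a^2x^2z^4-2yz^2+a^2z^6 :\\ & -2a^3x^6+14a^3x^4z^2+4ax^2y-14a^3x^2z^4-4ayz^2+2a^3z^6 : (x^2+z^2)^3\,]. \end{aligned}$$ For $Q\in E_a(\mathbb{Q})$ let $h(Q)$ be the logarithmic height of the $x$-coordinate of $Q$ (that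 is, $h(Q)=\log\max\{|r|,|s|\}$ if $x(Q)=r/s$ in lowest terms, and $h(\mathcal{O})=0$), and let $\hat h_{E_a}(Q)=\lim_{n\to\infty}4^{-n}h(2^nQ)$ be the canonical height. Then for every $P\in C_a(\mathbb{Q})$, $$\left|\hat h_{E_a}(\varphi_1(P))-\hat h_{E_a}(\varphi_2(P))\right|\le 51.18+2\log|a|.$$ -/

import Mathlib

open Filter Topology

namespace DemyanenkoManin

noncomputable section

/-! ### The hyperelliptic curve `C_a` -/

/-- The binary octic form whose dehomogenisation is
`x⁸ + (4 - 4a⁴) x⁶ + (8a⁴ + 6) x⁴ + (4 - 4a⁴) x² + 1`. -/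
def octic (a : ℤ) (X Z : ℚ) : ℚ :=
  X ^ 8 + (4 - 4 * (a : ℚ) ^ 4) * X ^ 6 * Z ^ 2 + (8 * (a : ℚ) ^ 4 + 6) * X ^ 4 * Z ^ 4
    + (4 - 4 * (a : ℚ) ^ 4) * X ^ 2 * Z ^ 6 + Z ^ 8

/-- Weighted homogeneous coordinates (of weights `1, 4, 1`) of rational points of the smooth
projective model `Y² = X⁸ + (4 - 4a⁴) X⁶ Z² + (8a⁴ + 6) X⁴ Z⁴ + (4 - 4a⁴) X² Z⁶ + Z⁸` of `C_a`.
When `X = Z = 0` the equation forces `Y = 0`, so `(X, Z) ≠ (0, 0)` is the condition that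
not all coordinates vanish. -/
@[ext]
structure CurveCoords (a : ℤ) where
  X : ℚ
  Y : ℚ
  Z : ℚ
  ne_zero : X ≠ 0 ∨ Z ≠ 0
  equation : Y ^ 2 = octic a X Z

/-- Two coordinate triples represent the same point of `ℙ(1, 4, 1)` iff they differ by the
weighted action `(X, Y, Z) ↦ (tX, t⁴Y, tZ)` of a nonzero scalar `t`. -/
instance curveSetoid (a : ℤ) : Setoid (CurveCoords a) where
  r p q := ∃ t : ℚ, t ≠ 0 ∧ q.X = t * p.X ∧ q.Y = t ^ 4 * p.Y ∧ q.Z = t * p.Z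
  iseqv :=
    { refl := fun p => ⟨1, one_ne_zero, by simp, by simp, by simp⟩
      symm := by
        rintro p q ⟨t, ht, h1, h2, h3⟩
        exact ⟨t⁻¹, inv_ne_zero ht, by rw [h1]; field_simp, by rw [h2]; field_simp,
          by rw [h3]; field_simp⟩
      trans := by
        rintro p q r ⟨t, ht, h1, h2, h3⟩ ⟨s, hs, k1, k2, k3⟩
        exact ⟨s * t, mul_ne_zero hs ht, by rw [k1, h1]; ring, by rw [k2, h2]; ring,
          by rw [k3, h3]; ring⟩ }

/-- The set `C_a(ℚ)` of rational points of the smooth projective curve `C_a`, including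
the two points `(1 : ±1 : 0)` at infinity. -/
def Curve (a : ℤ) : Type := Quotient (curveSetoid a)

/-! ### The elliptic curve `E_a` -/

/-- `E_a : y² = x³ + 2a² x² + (a⁴ - 4) x` over `ℚ`. -/
def E (a : ℤ) : WeierstrassCurve.Affine ℚ where
  a₁ := 0
  a₂ := 2 * (a : ℚ) ^ 2
  a₃ := 0
  a₄ := (a : ℚ) ^ 4 - 4
  a₆ := 0

theorem four_ne (a : ℤ) : (a : ℚ) ^ 4 - 4 ≠ 0 := by
  intro h
  have h1 : (a ^ 2 - 2) * (a ^ 2 + 2) = 0 := by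
    have : (((a ^ 2 - 2) * (a ^ 2 + 2) : ℤ) : ℚ) = 0 := by push_cast; linarith
    exact_mod_cast this
  have h2 : a ^ 2 = 2 := by
    rcases mul_eq_zero.mp h1 with h | h
    · linarith
    · nlinarith [sq_nonneg a]
  have h3 : a < 2 := by nlinarith
  have h4 : -2 < a := by nlinarith
  interval_cases a <;> omega

instance (a : ℤ) : (E a).IsElliptic := by
  rw [WeierstrassCurve.isElliptic_iff, isUnit_iff_ne_zero]
  have : (E a).Δ = 256 * ((a : ℚ) ^ 4 - 4) ^ 2 := by
    simp only [WeierstrassCurve.Δ, WeierstrassCurve.b₂, WeierstrassCurve.b₄, WeierstrassCurve.b₆,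
      WeierstrassCurve.b₈, E]
    ring
  rw [this]
  exact mul_ne_zero (by norm_num) (pow_ne_zero 2 (four_ne a))

/-! ### The two maps `φ₁, φ₂ : C_a → E_a` -/

/-- The first homogeneous coordinate of the first map `φ₁ = [phi1X : phi1Y : phiZ]`. -/
def phi1X (a : ℤ) (x y z : ℚ) : ℚ :=
  -(a : ℚ) ^ 2 * x ^ 6 + 5 * (a : ℚ) ^ 2 * x ^ 4 * z ^ 2 - 2 * x ^ 2 * y
    + 5 * (a : ℚ) ^ 2 * x ^ 2 * z ^ 4 - 2 * y * z ^ 2 - (a : ℚ) ^ 2 * z ^ 6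

/-- The second homogeneous coordinate of `φ₁`. -/
def phi1Y (a : ℤ) (x y z : ℚ) : ℚ :=
  4 * (a : ℚ) ^ 3 * x ^ 5 * z - 24 * (a : ℚ) ^ 3 * x ^ 3 * z ^ 3 + 8 * (a : ℚ) * x * y * z
    + 4 * (a : ℚ) ^ 3 * x * z ^ 5

/-- The first homogeneous coordinate of the second map `φ₂ = [phi2X : phi2Y : phiZ]`. -/
def phi2X (a : ℤ) (x y z : ℚ) : ℚ :=
  (a : ℚ) ^ 2 * x ^ 6 - 5 * (a : ℚ) ^ 2 * x ^ 4 * z ^ 2 - 2 * x ^ 2 * y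
    - 5 * (a : ℚ) ^ 2 * x ^ 2 * z ^ 4 - 2 * y * z ^ 2 + (a : ℚ) ^ 2 * z ^ 6

/-- The second homogeneous coordinate of `φ₂`. -/
def phi2Y (a : ℤ) (x y z : ℚ) : ℚ :=
  -2 * (a : ℚ) ^ 3 * x ^ 6 + 14 * (a : ℚ) ^ 3 * x ^ 4 * z ^ 2 + 4 * (a : ℚ) * x ^ 2 * y
    - 14 * (a : ℚ) ^ 3 * x ^ 2 * z ^ 4 - 4 * (a : ℚ) * y * z ^ 2 + 2 * (a : ℚ) ^ 3 * z ^ 6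

/-- The common last homogeneous coordinate of the two maps; it equals `(x² + z²)³` and so does
not vanish at rational points. -/
def phiZ (x z : ℚ) : ℚ := x ^ 6 + 3 * x ^ 4 * z ^ 2 + 3 * x ^ 2 * z ^ 4 + z ^ 6

theorem phiZ_eq (x z : ℚ) : phiZ x z = (x ^ 2 + z ^ 2) ^ 3 := by
  unfold phiZ; ring

theorem sq_add_sq_ne {a : ℤ} (p : CurveCoords a) : p.X ^ 2 + p.Z ^ 2 ≠ 0 := by
  rcases p.ne_zero with h | h <;> positivity

theorem phiZ_ne {a : ℤ} (p : CurveCoords a) : phiZ p.X p.Z ≠ 0 := by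
  rw [phiZ_eq]; exact pow_ne_zero 3 (sq_add_sq_ne p)

theorem phi1_equation {a : ℤ} (p : CurveCoords a) :
    (E a).Equation (phi1X a p.X p.Y p.Z / phiZ p.X p.Z) (phi1Y a p.X p.Y p.Z / phiZ p.X p.Z) := by
  have h := p.equation
  have hd := sq_add_sq_ne p
  rw [WeierstrassCurve.Affine.equation_iff, phiZ_eq]
  simp only [E]
  unfold octic at h
  rw [show phi1X a p.X p.Y p.Z = (p.X ^ 2 + p.Z ^ 2) * (-(a : ℚ) ^ 2 * p.X ^ 4 + 6 * a ^ 2 * p.X ^ 2 * p.Z ^ 2 - 2 * p.Y - a ^ 2 * p.Z ^ 4) by unfold phi1X; ring,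
    show phi1Y a p.X p.Y p.Z = (-4 * a * p.X * p.Z) * (-(a : ℚ) ^ 2 * p.X ^ 4 + 6 * a ^ 2 * p.X ^ 2 * p.Z ^ 2 - 2 * p.Y - a ^ 2 * p.Z ^ 4) by
      unfold phi1Y; ring]
  set A : ℚ := -(a : ℚ) ^ 2 * p.X ^ 4 + 6 * a ^ 2 * p.X ^ 2 * p.Z ^ 2 - 2 * p.Y - a ^ 2 * p.Z ^ 4 with hA
  have key : A * (16 * a ^ 2 * p.X ^ 2 * p.Z ^ 2 * A) = A * (A ^ 2
      + 2 * a ^ 2 * (p.X ^ 2 + p.Z ^ 2) ^ 2 * A + (a ^ 4 - 4) * (p.X ^ 2 + p.Z ^ 2) ^ 4) := by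
    congr 1
    rw [hA]
    linear_combination (-4) * h
  clear_value A
  field_simp
  linear_combination key

theorem phi2_equation {a : ℤ} (p : CurveCoords a) :
    (E a).Equation (phi2X a p.X p.Y p.Z / phiZ p.X p.Z) (phi2Y a p.X p.Y p.Z / phiZ p.X p.Z) := by
  have h := p.equation
  have hd := sq_add_sq_ne p
  rw [WeierstrassCurve.Affine.equation_iff, phiZ_eq]
  simp only [E]
  unfold octic at h
  rw [show phi2X a p.X p.Y p.Z = (p.X ^ 2 + p.Z ^ 2) * ((a : ℚ) ^ 2 * p.X ^ 4 - 6 * a ^ 2 * p.X ^ 2 * p.Z ^ 2 - 2 * p.Y + a ^ 2 * p.Z ^ 4) by unfold phi2X; ring,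
    show phi2Y a p.X p.Y p.Z = (-2 * a * (p.X ^ 2 - p.Z ^ 2)) * ((a : ℚ) ^ 2 * p.X ^ 4 - 6 * a ^ 2 * p.X ^ 2 * p.Z ^ 2 - 2 * p.Y + a ^ 2 * p.Z ^ 4) by
      unfold phi2Y; ring]
  set A : ℚ := (a : ℚ) ^ 2 * p.X ^ 4 - 6 * a ^ 2 * p.X ^ 2 * p.Z ^ 2 - 2 * p.Y + a ^ 2 * p.Z ^ 4 with hA
  have key : A * (4 * a ^ 2 * (p.X ^ 2 - p.Z ^ 2) ^ 2 * A) = A * (A ^ 2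
      + 2 * a ^ 2 * (p.X ^ 2 + p.Z ^ 2) ^ 2 * A + (a ^ 4 - 4) * (p.X ^ 2 + p.Z ^ 2) ^ 4) := by
    congr 1
    rw [hA]
    linear_combination (-4) * h
  clear_value A
  field_simp
  linear_combination key

/-- The map `φ₁` on coordinate triples. -/
def phi1Coords {a : ℤ} (p : CurveCoords a) : (E a).Point :=
  .some (phi1X a p.X p.Y p.Z / phiZ p.X p.Z) (phi1Y a p.X p.Y p.Z / phiZ p.X p.Z)
    (WeierstrassCurve.Affine.equation_iff_nonsingular.mp (phi1_equation p))

/-- The map `φ₂` on coordinate triples. -/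
def phi2Coords {a : ℤ} (p : CurveCoords a) : (E a).Point :=
  .some (phi2X a p.X p.Y p.Z / phiZ p.X p.Z) (phi2Y a p.X p.Y p.Z / phiZ p.X p.Z)
    (WeierstrassCurve.Affine.equation_iff_nonsingular.mp (phi2_equation p))

/-- The map `φ₁ : C_a(ℚ) → E_a(ℚ)`. -/
def phi1 {a : ℤ} (P : Curve a) : (E a).Point :=
  Quotient.lift (s := curveSetoid a) phi1Coords (by
    rintro p q ⟨t, ht, h1, h2, h3⟩
    have hp := phiZ_ne p
    have e : phiZ q.X q.Z = t ^ 6 * phiZ p.X p.Z := by rw [h1, h3]; unfold phiZ; ring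
    have e1 : phi1X a q.X q.Y q.Z = t ^ 6 * phi1X a p.X p.Y p.Z := by
      rw [h1, h2, h3]; unfold phi1X; ring
    have e2 : phi1Y a q.X q.Y q.Z = t ^ 6 * phi1Y a p.X p.Y p.Z := by
      rw [h1, h2, h3]; unfold phi1Y; ring
    simp only [phi1Coords, WeierstrassCurve.Affine.Point.some.injEq]
    rw [e, e1, e2]
    constructor <;> field_simp) P

/-- The map `φ₂ : C_a(ℚ) → E_a(ℚ)`. -/
def phi2 {a : ℤ} (P : Curve a) : (E a).Point :=
  Quotient.lift (s := curveSetoid a) phi2Coords (by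
    rintro p q ⟨t, ht, h1, h2, h3⟩
    have hp := phiZ_ne p
    have e : phiZ q.X q.Z = t ^ 6 * phiZ p.X p.Z := by rw [h1, h3]; unfold phiZ; ring
    have e1 : phi2X a q.X q.Y q.Z = t ^ 6 * phi2X a p.X p.Y p.Z := by
      rw [h1, h2, h3]; unfold phi2X; ring
    have e2 : phi2Y a q.X q.Y q.Z = t ^ 6 * phi2Y a p.X p.Y p.Z := by
      rw [h1, h2, h3]; unfold phi2Y; ring
    simp only [phi2Coords, WeierstrassCurve.Affine.Point.some.injEq]
    rw [e, e1, e2]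
    constructor <;> field_simp) P

/-! ### Heights on an elliptic curve over `ℚ` -/

/-- The naive height `h(P) = h(x(P))`: the logarithmic Weil height of the `x`-coordinate, with
`h(𝓞) = 0`, as `x(𝓞) = [1 : 0]`. For a fraction `r / s` in lowest terms this is
`log (max |r| |s|)`. -/
def naiveHeight {W : WeierstrassCurve.Affine ℚ} : W.Point → ℝ
  | .zero => 0
  | .some x _ _ => Height.logHeight₁ x

/-- The canonical (Néron–Tate) height `ĥ(P) = lim_{n → ∞} 4⁻ⁿ h(2ⁿ P)`, normalised so that
`ĥ - h` is bounded for the naive height `h` of the `x`-coordinate. -/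
def canonicalHeight {W : WeierstrassCurve.Affine ℚ} (P : W.Point) : ℝ :=
  limUnder atTop fun n : ℕ => naiveHeight ((2 ^ n : ℕ) • P) / (4 : ℝ) ^ n

/-! The limit defining the canonical height exists for every point of `E_a`. -/

/-- The binary form of degree `N` with coefficients `c`. -/
def binForm (N : ℕ) (c : Fin (N + 1) → ℚ) : MvPolynomial (Fin 2) ℚ :=
  ∑ i : Fin (N + 1), MvPolynomial.C (c i) * (MvPolynomial.X 0 ^ (i : ℕ) *
    MvPolynomial.X 1 ^ (N - (i : ℕ)))

theorem binForm_homogeneous (N : ℕ) (c : Fin (N + 1) → ℚ) : (binForm N c).IsHomogeneous N := by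
  refine MvPolynomial.IsHomogeneous.sum _ _ _ fun i _ => ?_
  have h := (MvPolynomial.isHomogeneous_C (Fin 2) (c i)).mul
    (((MvPolynomial.isHomogeneous_X ℚ (0 : Fin 2)).pow (i : ℕ)).mul
      ((MvPolynomial.isHomogeneous_X ℚ (1 : Fin 2)).pow (N - (i : ℕ))))
  convert h using 1
  have := i.is_lt
  omega

/-- Numerator and denominator of the duplication formula for the `x`-coordinate. -/
def dupl (b c : ℚ) : Fin 2 → MvPolynomial (Fin 2) ℚ :=
  ![binForm 4 ![b ^ 2, 0, -2 * b, 0, 1], binForm 4 ![0, 4 * b, 4 * c, 4, 0]]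

theorem naiveHeight_two_smul (a : ℤ) :
    ∃ C : ℝ, ∀ P : (E a).Point, |naiveHeight (2 • P) - 4 * naiveHeight P| ≤ C := by
  set b : ℚ := (a : ℚ) ^ 4 - 4 with hb
  set c : ℚ := 2 * (a : ℚ) ^ 2 with hc
  have hb0 : b ≠ 0 := four_ne a
  have hcb : c ^ 2 = 4 * b + 16 := by rw [hb, hc]; ring
  obtain ⟨C₁, h₁⟩ := Height.logHeight_eval_le' (K := ℚ) (N := 4) (p := dupl b c)
    (by intro i; fin_cases i <;> exact binForm_homogeneous _ _)
  let q : Fin 2 × Fin 2 → MvPolynomial (Fin 2) ℚ := fun kj =>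
    (![![binForm 3 ![0, -12 * b ^ 2 / 64, -8 * b * c / 64, 1],
        binForm 3 ![3 * b ^ 3 / 64, - b ^ 2 * c / 64, -5 * b ^ 2 / 64, 2 * b * c / 64]],
      ![binForm 3 ![64 / (64 * b ^ 2), -8 * c / (64 * b ^ 2), -12 / (64 * b ^ 2), 0],
        binForm 3 ![2 * b * c / (64 * b ^ 2), -5 * b / (64 * b ^ 2), - c / (64 * b ^ 2),
          3 / (64 * b ^ 2)]]] : Fin 2 → Fin 2 → MvPolynomial (Fin 2) ℚ) kj.1 kj.2
  obtain ⟨C₂, h₂⟩ := Height.logHeight_eval_ge' (K := ℚ) (M := 3) (N := 4) (q := q)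
    (by rintro ⟨i, j⟩; fin_cases i <;> fin_cases j <;> exact binForm_homogeneous _ _)
  have key : ∀ x : ℚ, |Height.logHeight ![(x ^ 2 - b) ^ 2, 4 * (x * (x ^ 2 + c * x + b))]
      - 4 * Height.logHeight₁ x| ≤ max C₁ (-C₂) := by
    intro x
    have hv : (fun j => (dupl b c j).eval ![x, 1]) =
        ![(x ^ 2 - b) ^ 2, 4 * (x * (x ^ 2 + c * x + b))] := by
      funext j
      fin_cases j <;> simp [dupl, binForm, Fin.sum_univ_succ] <;> ring
    have u₁ := h₁ ![x, 1]
    have u₂ := h₂ (dupl b c) (x := ![x, 1]) (by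
      intro k
      fin_cases k
      · simp [q, dupl, binForm, Fin.sum_univ_succ]
        linear_combination (-b ^ 2 / 16 * x ^ 3 + b / 8 * x ^ 5) * hcb
      · simp [q, dupl, binForm, Fin.sum_univ_succ]
        field_simp
        linear_combination (8 * b * x ^ 2 - 4 * x ^ 4) * hcb)
    rw [hv, ← Height.logHeight₁_eq_logHeight] at u₁ u₂
    push_cast at u₁ u₂
    rw [abs_sub_le_iff]
    exact ⟨by linarith [le_max_left C₁ (-C₂)], by linarith [le_max_right C₁ (-C₂)]⟩
  refine ⟨max 0 (max C₁ (-C₂)), ?_⟩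
  rintro (_ | ⟨x, y, h⟩)
  · have : (2 • (WeierstrassCurve.Affine.Point.zero : (E a).Point)) = .zero :=
      smul_zero (A := (E a).Point) 2
    rw [this]; simp [naiveHeight]
  · refine le_trans ?_ ((key x).trans (le_max_right _ _))
    have heq : y ^ 2 = x * (x ^ 2 + c * x + b) := by
      have := (WeierstrassCurve.Affine.equation_iff ..).mp h.1
      simp only [E] at this
      rw [hb, hc]; linarith
    rw [← heq, ← Height.logHeight₁_div_eq_logHeight]
    apply le_of_eq
    congr 2
    rw [two_smul]
    by_cases hy : y = 0
    · rw [WeierstrassCurve.Affine.Point.add_self_of_Y_eq (by simp [E, hy])]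
      subst hy
      simp only [ne_eq, OfNat.ofNat_ne_zero, not_false_eq_true, zero_pow, mul_zero, div_zero,
        Height.logHeight₁_zero]
      rfl
    · have hne : y ≠ (E a).negY x y := by
        simp only [WeierstrassCurve.Affine.negY, E]
        intro h'
        exact hy (by linarith)
      rw [WeierstrassCurve.Affine.Point.add_self_of_Y_ne hne]
      simp only [naiveHeight]
      congr 1
      rw [WeierstrassCurve.Affine.slope_of_Y_ne rfl hne]
      simp only [WeierstrassCurve.Affine.addX, WeierstrassCurve.Affine.negY, E]
      rw [← hb, ← hc]
      have : y - (-y - 0 * x - 0) = 2 * y := by ring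
      rw [this]
      field_simp
      linear_combination (-16 * c - 32 * x) * heq

theorem tendsto_canonicalHeight {a : ℤ} (P : (E a).Point) :
    Tendsto (fun n : ℕ => naiveHeight ((2 ^ n : ℕ) • P) / (4 : ℝ) ^ n) atTop
      (𝓝 (canonicalHeight P)) := by
  obtain ⟨C, hC⟩ := naiveHeight_two_smul a
  refine CauchySeq.tendsto_limUnder ?_
  refine cauchySeq_of_le_geometric (1 / 4) (C / 4) (by norm_num) fun n => ?_
  have h := hC ((2 ^ n : ℕ) • P)
  rw [smul_smul, ← pow_succ'] at h
  rw [dist_comm, Real.dist_eq]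
  have e : naiveHeight ((2 ^ (n + 1) : ℕ) • P) / (4 : ℝ) ^ (n + 1)
      - naiveHeight ((2 ^ n : ℕ) • P) / (4 : ℝ) ^ n
      = (naiveHeight ((2 ^ (n + 1) : ℕ) • P) - 4 * naiveHeight ((2 ^ n : ℕ) • P))
        / (4 : ℝ) ^ (n + 1) := by
    rw [pow_succ (4 : ℝ)]; field_simp
  rw [e, abs_div, abs_of_pos (by positivity : (0 : ℝ) < 4 ^ (n + 1))]
  calc _ ≤ C / 4 ^ (n + 1) := by gcongr
    _ = C / 4 * (1 / 4) ^ n := by rw [pow_succ, one_div, inv_pow]; field_simp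

end

end DemyanenkoManin

/-!
The two maps satisfy `x(φ₁ P) * x(φ₂ P) = -(a⁴ - 4)`. Since translation by the `2`-torsion point
`(0, 0)` is `x ↦ (a⁴ - 4) / x`, this says that `φ₂ P` is, up to the sign of `x`, the translate of
`φ₁ P` by `(0, 0)`; in terms of the `2`-isogeny `X = (x² + 2a²x + a⁴ - 4) / (4x)`, the images of
`φ₁ P` and `φ₂ P` satisfy `X₁ + X₂ = a²`. Doubling factors through this isogeny, and the second
factor `X ↦ (1 - X (a² - X)) / X` has the same numerator at `X₁` and `X₂` and creates no
cancellation. Hence the heights of `2 φ₁ P` and `2 φ₂ P` differ by `O(1 + log |a|)`.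

The roots of `x² + 2a²x + a⁴ - 4` have size `a²`, so the height is measured with the archimedean
absolute value rescaled by `a²`. At points with `x ≥ 0`, which includes all doubled points, it
then satisfies `4 h(Q) - 8 log |a| - O(1) ≤ h(2Q) ≤ 4 h(Q) + O(1)`, and telescoping compares it
with the canonical height.
-/

namespace DemyanenkoManin

open WeierstrassCurve.Affine (Point)

section XCoordinate

variable {K : Type*} [Field K] {W : WeierstrassCurve.Affine K}

/-- The `x`-coordinate of the point, viewed in `ℙ¹` with `x(𝓞) = [1 : 0]`, is `[r : s]`. -/
def HasXCoord (r s : K) : W.Point → Prop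
  | .zero => r ≠ 0 ∧ s = 0
  | .some x _ _ => s ≠ 0 ∧ r = x * s

theorem hasXCoord_mul_left_iff {k r s : K} (hk : k ≠ 0) {P : W.Point} :
    HasXCoord (k * r) (k * s) P ↔ HasXCoord r s P := by
  rcases P with _ | ⟨x, y, h⟩
  · simp [HasXCoord, hk]
  · simp [HasXCoord, hk, mul_left_comm x k s]

theorem sq_sub_negY_of_equation {x y : K} (h : W.Equation x y) :
    (y - W.negY x y) ^ 2 = 4 * x ^ 3 + W.b₂ * x ^ 2 + 2 * W.b₄ * x + W.b₆ := by
  rw [WeierstrassCurve.Affine.equation_iff] at h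
  simp only [WeierstrassCurve.Affine.negY, WeierstrassCurve.b₂, WeierstrassCurve.b₄,
    WeierstrassCurve.b₆]
  linear_combination 4 * h

/-- The formula `x(2P) = λ² + a₁λ - a₂ - 2x`, where `λ` is the slope of the tangent line at `P`,
with denominators cleared. -/
theorem duplication_num_eq_of_equation {x y : K} (h : W.Equation x y) :
    x ^ 4 - W.b₄ * x ^ 2 - 2 * W.b₆ * x - W.b₈ =
      (3 * x ^ 2 + 2 * W.a₂ * x + W.a₄ - W.a₁ * y) ^ 2
        + W.a₁ * (3 * x ^ 2 + 2 * W.a₂ * x + W.a₄ - W.a₁ * y) * (y - W.negY x y)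
        - (W.a₂ + 2 * x) * (y - W.negY x y) ^ 2 := by
  rw [WeierstrassCurve.Affine.equation_iff] at h
  simp only [WeierstrassCurve.Affine.negY, WeierstrassCurve.b₄, WeierstrassCurve.b₆,
    WeierstrassCurve.b₈]
  linear_combination (W.a₁ ^ 2 + 4 * W.a₂ + 8 * x) * h

theorem HasXCoord.two_smul [DecidableEq K] {r s : K} {P : W.Point} (h : HasXCoord r s P) :
    HasXCoord (r ^ 4 - W.b₄ * r ^ 2 * s ^ 2 - 2 * W.b₆ * r * s ^ 3 - W.b₈ * s ^ 4)
      (s * (4 * r ^ 3 + W.b₂ * r ^ 2 * s + 2 * W.b₄ * r * s ^ 2 + W.b₆ * s ^ 3)) (2 • P) := by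
  rcases P with _ | ⟨x, y, hxy⟩
  · obtain ⟨hr, rfl⟩ := h
    rw [show 2 • (Point.zero : W.Point) = .zero from smul_zero 2]
    simp [HasXCoord, hr]
  · obtain ⟨hs, rfl⟩ := h
    have hnum := duplication_num_eq_of_equation hxy.1
    have hden := sq_sub_negY_of_equation hxy.1
    rw [show (x * s) ^ 4 - W.b₄ * (x * s) ^ 2 * s ^ 2 - 2 * W.b₆ * (x * s) * s ^ 3 - W.b₈ * s ^ 4
        = s ^ 4 * (x ^ 4 - W.b₄ * x ^ 2 - 2 * W.b₆ * x - W.b₈) by ring,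
      show s * (4 * (x * s) ^ 3 + W.b₂ * (x * s) ^ 2 * s + 2 * W.b₄ * (x * s) * s ^ 2
        + W.b₆ * s ^ 3) = s ^ 4 * (4 * x ^ 3 + W.b₂ * x ^ 2 + 2 * W.b₄ * x + W.b₆) by ring,
      hasXCoord_mul_left_iff (pow_ne_zero 4 hs), hnum, ← hden, _root_.two_smul]
    by_cases hy : y = W.negY x y
    · have hslope : 3 * x ^ 2 + 2 * W.a₂ * x + W.a₄ - W.a₁ * y ≠ 0 := by
        rcases ((WeierstrassCurve.Affine.nonsingular_iff ..).mp hxy).2 with h | h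
        · exact sub_ne_zero.mpr h.symm
        · exact absurd hy h
      rw [WeierstrassCurve.Affine.Point.add_self_of_Y_eq hy, ← hy, sub_self]
      exact ⟨by simpa using hslope, by simp⟩
    · have hη : y - W.negY x y ≠ 0 := sub_ne_zero.mpr hy
      rw [WeierstrassCurve.Affine.Point.add_self_of_Y_ne hy]
      refine ⟨pow_ne_zero 2 hη, ?_⟩
      rw [WeierstrassCurve.Affine.slope_of_Y_ne rfl hy, WeierstrassCurve.Affine.addX]
      field_simp
      ring

end XCoordinate

section Rational

variable {W : WeierstrassCurve.Affine ℚ}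

theorem exists_isCoprime_hasXCoord (P : W.Point) :
    ∃ r s : ℤ, IsCoprime r s ∧ HasXCoord (r : ℚ) s P := by
  rcases P with _ | ⟨x, y, h⟩
  · exact ⟨1, 0, isCoprime_one_left, by simp [HasXCoord]⟩
  · exact ⟨x.num, x.den, Rat.isCoprime_num_den x, by simp [HasXCoord]⟩

/-- The naive height with the archimedean absolute value of the denominator multiplied by `A`,
which adapts the height to curves whose `2`-torsion points have `x`-coordinates of size `A`. -/
noncomputable def scaledHeight (A : ℝ) : W.Point → ℝ
  | .zero => 0
  | .some x _ _ => Real.log (max |(x.num : ℝ)| (A * x.den))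

theorem HasXCoord.scaledHeight_eq {r s : ℤ} {P : W.Point} (h : HasXCoord (r : ℚ) s P)
    (hrs : IsCoprime r s) (A : ℝ) :
    scaledHeight A P = Real.log (max |(r : ℝ)| (A * |(s : ℝ)|)) := by
  rcases P with _ | ⟨x, y, hxy⟩
  · obtain rfl : s = 0 := mod_cast h.2
    have hr : |(r : ℝ)| = 1 :=
      mod_cast Int.isUnit_iff_abs_eq.mp (isCoprime_zero_right.mp hrs)
    simp [scaledHeight, hr]
  · obtain ⟨hs, hr⟩ := h
    obtain ⟨k, hkr, hks⟩ := Rat.exists_eq_mul_div_num_and_eq_mul_div_den r (mod_cast hs)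
    rw [← eq_div_of_mul_eq hs hr.symm] at hkr hks
    have hk : |(k : ℝ)| = 1 :=
      mod_cast Int.isUnit_iff_abs_eq.mp (hrs.isUnit_of_dvd' ⟨_, hkr⟩ ⟨_, hks⟩)
    rw [hkr, hks]
    simp [scaledHeight, abs_mul, hk]

theorem HasXCoord.exp_scaledHeight {r s : ℤ} {P : W.Point} (h : HasXCoord (r : ℚ) s P)
    (hrs : IsCoprime r s) {A : ℝ} (hA : 0 < A) :
    Real.exp (scaledHeight A P) = max |(r : ℝ)| (A * |(s : ℝ)|) := by
  rw [h.scaledHeight_eq hrs, Real.exp_log]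
  rcases hrs.ne_zero_or_ne_zero with hr | hs
  · exact lt_max_of_lt_left (by positivity)
  · exact lt_max_of_lt_right (by positivity)

theorem abs_scaledHeight_sub_naiveHeight_le {A : ℝ} (hA : 1 ≤ A) (P : W.Point) :
    |scaledHeight A P - naiveHeight P| ≤ Real.log A := by
  rcases P with _ | ⟨x, y, h⟩
  · simpa [scaledHeight, naiveHeight] using Real.log_nonneg hA
  · have hden : (1 : ℝ) ≤ x.den := mod_cast x.den_pos
    have hmax : (1 : ℝ) ≤ max |(x.num : ℝ)| x.den := le_max_of_le_right hden
    have hnaive : naiveHeight (.some x y h : W.Point) = Real.log (max |(x.num : ℝ)| x.den) := by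
      simp [naiveHeight, Rat.logHeight₁_eq_log_max, Nat.cast_natAbs]
    have hle : max |(x.num : ℝ)| x.den ≤ max |(x.num : ℝ)| (A * x.den) :=
      max_le_max le_rfl (le_mul_of_one_le_left (by positivity) hA)
    have hge : max |(x.num : ℝ)| (A * x.den) ≤ A * max |(x.num : ℝ)| x.den := by
      rw [mul_max_of_nonneg _ _ (by positivity)]
      exact max_le_max (le_mul_of_one_le_left (abs_nonneg _) hA) le_rfl
    have hloglow := Real.log_le_log (by positivity) hle
    have hloghigh := Real.log_le_log (by linarith) hge
    rw [Real.log_mul (by positivity) (by positivity)] at hloghigh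
    rw [hnaive, scaledHeight, abs_of_nonneg (by linarith)]
    linarith

end Rational

section Isogeny

variable {a : ℤ} {P : (E a).Point}

theorem HasXCoord.two_smul_E {r s : ℚ} (h : HasXCoord r s P) :
    HasXCoord ((r ^ 2 - ((a : ℚ) ^ 4 - 4) * s ^ 2) ^ 2)
      (4 * r * s * (r ^ 2 + 2 * a ^ 2 * r * s + ((a : ℚ) ^ 4 - 4) * s ^ 2)) (2 • P) := by
  convert h.two_smul using 1 <;>
    simp only [E, WeierstrassCurve.b₂, WeierstrassCurve.b₄, WeierstrassCurve.b₆,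
      WeierstrassCurve.b₈] <;> ring

theorem HasXCoord.mul_quadratic_nonneg {r s : ℚ} (h : HasXCoord r s P) :
    0 ≤ r * s * (r ^ 2 + 2 * a ^ 2 * r * s + ((a : ℚ) ^ 4 - 4) * s ^ 2) := by
  rcases P with _ | ⟨x, y, hxy⟩
  · simp [h.2]
  · obtain ⟨-, rfl⟩ := h
    have hy : y ^ 2 = x ^ 3 + 2 * (a : ℚ) ^ 2 * x ^ 2 + ((a : ℚ) ^ 4 - 4) * x := by
      simpa [E] using (WeierstrassCurve.Affine.equation_iff ..).mp hxy.1
    calc (0 : ℚ) ≤ (y * s ^ 2) ^ 2 := sq_nonneg _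
      _ = _ := by linear_combination s ^ 4 * hy

/-- The image of the point under the `2`-isogeny with kernel `{𝓞, (0, 0)}` has `x`-coordinate
`[n : m]`. The isogeny is normalised as `x ↦ y² / (4x²) = (x² + 2a²x + a⁴ - 4) / (4x)`, which
makes translation by `(0, 0)` on `-x` correspond to `X ↦ a² - X`. -/
def HasIsogenyCoord (n m : ℚ) (P : (E a).Point) : Prop :=
  ∃ r s k : ℚ, HasXCoord r s P ∧ k ≠ 0 ∧
    k * n = r ^ 2 + 2 * a ^ 2 * r * s + ((a : ℚ) ^ 4 - 4) * s ^ 2 ∧ k * m = 4 * r * s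

namespace HasIsogenyCoord

variable {n m : ℚ}

theorem two_smul (h : HasIsogenyCoord n m P) :
    HasXCoord (m ^ 2 - n * (a ^ 2 * m - n)) (m * n) (2 • P) := by
  obtain ⟨r, s, k, hP, hk, hn, hm⟩ := h
  rw [← hasXCoord_mul_left_iff (pow_ne_zero 2 hk)]
  convert hP.two_smul_E using 1
  · calc k ^ 2 * (m ^ 2 - n * (a ^ 2 * m - n))
        = (k * m) ^ 2 - k * n * (a ^ 2 * (k * m) - k * n) := by ring
      _ = _ := by rw [hn, hm]; ring
  · calc k ^ 2 * (m * n) = k * m * (k * n) := by ring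
      _ = _ := by rw [hn, hm]

theorem mul_nonneg (h : HasIsogenyCoord n m P) : 0 ≤ m * n := by
  obtain ⟨r, s, k, hP, hk, hn, hm⟩ := h
  refine nonneg_of_mul_nonneg_right (a := k ^ 2) ?_ (by positivity)
  calc 0 ≤ 4 * (r * s * (r ^ 2 + 2 * a ^ 2 * r * s + ((a : ℚ) ^ 4 - 4) * s ^ 2)) :=
        _root_.mul_nonneg (by norm_num) hP.mul_quadratic_nonneg
    _ = k * m * (k * n) := by rw [hn, hm]; ring
    _ = k ^ 2 * (m * n) := by ring

theorem sq_sub_mul_nonneg (h : HasIsogenyCoord n m P) : 0 ≤ m ^ 2 - n * (a ^ 2 * m - n) := by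
  obtain ⟨r, s, k, -, hk, hn, hm⟩ := h
  refine nonneg_of_mul_nonneg_right (a := k ^ 2) ?_ (by positivity)
  calc 0 ≤ (r ^ 2 - ((a : ℚ) ^ 4 - 4) * s ^ 2) ^ 2 := sq_nonneg _
    _ = (k * m) ^ 2 - k * n * (a ^ 2 * (k * m) - k * n) := by rw [hn, hm]; ring
    _ = k ^ 2 * (m ^ 2 - n * (a ^ 2 * m - n)) := by ring

theorem of_x_mul_x_eq {x₁ y₁ x₂ y₂ : ℚ} {h₁ : (E a).Nonsingular x₁ y₁}
    {h₂ : (E a).Nonsingular x₂ y₂} (h : HasIsogenyCoord n m (.some x₁ y₁ h₁))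
    (hx : x₁ * x₂ = -((a : ℚ) ^ 4 - 4)) :
    HasIsogenyCoord (a ^ 2 * m - n) m (.some x₂ y₂ h₂) := by
  obtain ⟨_, s, k, ⟨hs, rfl⟩, hk, hn, hm⟩ := h
  have hb := four_ne a
  have hx₁ : x₁ ≠ 0 := by
    rintro rfl
    exact hb (by linear_combination hx)
  refine ⟨-((a : ℚ) ^ 4 - 4) * s, x₁ * s, -((a : ℚ) ^ 4 - 4) * k,
    ⟨mul_ne_zero hx₁ hs, by rw [← hx]; ring⟩, mul_ne_zero (neg_ne_zero.mpr hb) hk, ?_, ?_⟩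
  · linear_combination ((a : ℚ) ^ 4 - 4) * hn - ((a : ℚ) ^ 4 - 4) * a ^ 2 * hm
  · linear_combination -((a : ℚ) ^ 4 - 4) * hm

end HasIsogenyCoord

end Isogeny

section Coprime

theorem exists_isCoprime_quadratic {R : Type*} [CommRing R] [IsDomain R] [IsBezout R]
    [GCDMonoid R] {r s : R} (hrs : IsCoprime r s) (b c : R) :
    ∃ k n m : R, k ∣ 4 * b ∧ IsCoprime n m ∧
      k * n = r ^ 2 + c * r * s + b * s ^ 2 ∧ k * m = 4 * r * s := by
  obtain ⟨n, m, hn, hm, hnm⟩ := extract_gcd (r ^ 2 + c * r * s + b * s ^ 2) (4 * r * s)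
  set k := gcd (r ^ 2 + c * r * s + b * s ^ 2) (4 * r * s)
  refine ⟨k, n, m, ?_, (gcd_isUnit_iff n m).mp hnm, hn.symm, hm.symm⟩
  have hr : k ∣ 4 * b * r ^ 3 := ⟨n * (4 * b * r) - m * (b * (c * r + b * s)), by
    linear_combination (4 * b * r) * hn - (b * (c * r + b * s)) * hm⟩
  have hs : k ∣ 4 * b * s ^ 3 := ⟨n * (4 * s) - m * (r + c * s), by
    linear_combination (4 * s) * hn - (r + c * s) * hm⟩
  obtain ⟨u, v, huv⟩ : IsCoprime (r ^ 3) (s ^ 3) := hrs.pow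
  rw [show 4 * b = u * (4 * b * r ^ 3) + v * (4 * b * s ^ 3) by
    linear_combination -(4 * b) * huv]
  exact dvd_add (hr.mul_left _) (hs.mul_left _)

theorem isCoprime_sq_sub_mul {R : Type*} [CommRing R] {d n m : R} (h : IsCoprime n m) :
    IsCoprime (m ^ 2 - n * (d * m - n)) (m * n) := by
  refine IsCoprime.mul_right ?_ ?_
  · rw [show m ^ 2 - n * (d * m - n) = n ^ 2 + m * (m - n * d) by ring]
    exact h.pow_left.add_mul_left_left _
  · rw [show m ^ 2 - n * (d * m - n) = m ^ 2 + n * (-(d * m - n)) by ring]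
    exact h.symm.pow_left.add_mul_left_left _

end Coprime

section Archimedean

variable {r S B : ℝ}

theorem max_duplication_le (hr : 0 ≤ r) (hS : 0 ≤ S) (hBl : -3 * S ^ 2 ≤ B) (hBu : B ≤ S ^ 2) :
    max ((r ^ 2 - B) ^ 2) (4 * r * S * (r ^ 2 + 2 * r * S + B)) ≤ 16 * max r S ^ 4 := by
  set M := max r S
  have hrM : r ≤ M := le_max_left r S
  have hSM : S ≤ M := le_max_right r S
  have hr2 : r ^ 2 ≤ M ^ 2 := by gcongr
  have hS2 : S ^ 2 ≤ M ^ 2 := by gcongr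
  refine max_le ?_ ?_
  · calc (r ^ 2 - B) ^ 2 ≤ (4 * M ^ 2) ^ 2 :=
          sq_le_sq' (by linarith [sq_nonneg r, sq_nonneg M]) (by linarith)
      _ = 16 * M ^ 4 := by ring
  · calc 4 * r * S * (r ^ 2 + 2 * r * S + B) ≤ 4 * r * S * (r ^ 2 + 2 * r * S + S ^ 2) := by
          gcongr
      _ ≤ 4 * M * M * (M ^ 2 + 2 * M * M + M ^ 2) := by gcongr
      _ = 16 * M ^ 4 := by ring

theorem max_sq_le_two_mul_abs_or (hr : 0 ≤ r) (hS : 0 ≤ S)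
    (hB : B ≤ -S ^ 2 ∨ 3 / 4 * S ^ 2 ≤ B ∧ B ≤ S ^ 2) :
    max r S ^ 2 ≤ 2 * |r ^ 2 - B| ∨
      max r S ^ 2 ≤ 4 * r * S ∧ max r S ^ 2 ≤ r ^ 2 + 2 * r * S + B := by
  have hrS : 0 ≤ r * S := mul_nonneg hr hS
  have hle := le_abs_self (r ^ 2 - B)
  rcases hB with hB | ⟨hBl, hBu⟩
  · have hmax : max r S ^ 2 ≤ r ^ 2 + S ^ 2 := by
      rcases max_choice r S with h | h <;> rw [h] <;> linarith [sq_nonneg r, sq_nonneg S]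
    exact .inl (by linarith [sq_nonneg r, sq_nonneg S])
  rcases le_total (4 * r) S with hsmall | hsmall
  · rw [max_eq_right (by linarith)]
    exact .inl (by nlinarith [neg_abs_le (r ^ 2 - B)])
  rcases le_total (2 * S) r with hlarge | hlarge
  · rw [max_eq_left (by linarith)]
    exact .inl (by nlinarith)
  · rcases max_choice r S with h | h <;> rw [h] <;> exact .inr ⟨by nlinarith, by nlinarith⟩

theorem max_pow_four_le_max_duplication (hr : 0 ≤ r) (hS : 0 ≤ S)
    (hB : B ≤ -S ^ 2 ∨ 3 / 4 * S ^ 2 ≤ B ∧ B ≤ S ^ 2) :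
    max r S ^ 4 ≤ 4 * max ((r ^ 2 - B) ^ 2) (4 * r * S * (r ^ 2 + 2 * r * S + B)) := by
  rcases max_sq_le_two_mul_abs_or hr hS hB with h | ⟨h₁, h₂⟩
  · calc max r S ^ 4 = (max r S ^ 2) ^ 2 := by ring
      _ ≤ (2 * |r ^ 2 - B|) ^ 2 := by gcongr
      _ = 4 * (r ^ 2 - B) ^ 2 := by rw [mul_pow, sq_abs]; norm_num
      _ ≤ _ := by gcongr; exact le_max_left _ _
  · have hprod : max r S ^ 4 ≤ 4 * r * S * (r ^ 2 + 2 * r * S + B) := by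
      calc max r S ^ 4 = max r S ^ 2 * max r S ^ 2 := by ring
        _ ≤ _ := by gcongr
    have := le_max_right ((r ^ 2 - B) ^ 2) (4 * r * S * (r ^ 2 + 2 * r * S + B))
    linarith [show 0 ≤ max r S ^ 4 by positivity]

theorem max_isogeny_le {A m n n' : ℝ} (hA : 1 ≤ A) (hmn : 0 ≤ m * n) (hmn' : 0 ≤ m * n')
    (hsum : n + n' = A * m) (hm : 0 ≤ m ^ 2 - n * n') :
    max (m ^ 2 - n * n') (A * (m * n)) ≤
      2 * A ^ 2 * max (m ^ 2 - n * n') (A * (m * n')) := by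
  set M := max (m ^ 2 - n * n') (A * (m * n'))
  have hM₁ : m ^ 2 - n * n' ≤ M := le_max_left _ _
  have hM₂ : A * (m * n') ≤ M := le_max_right _ _
  have hM : 0 ≤ M := hm.trans hM₁
  have hmn_le : m * n ≤ A * m ^ 2 := by
    linear_combination m * hsum + hmn'
  have hm_le : m ^ 2 ≤ 2 * M := by
    rcases eq_or_ne m 0 with rfl | hm0
    · simpa using hM
    have hnn' : n * n' ≤ M := by
      refine le_of_mul_le_mul_left ?_ (by positivity : 0 < m ^ 2)
      calc m ^ 2 * (n * n') = m * n * (m * n') := by ring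
        _ ≤ A * m ^ 2 * (m * n') := by gcongr
        _ = m ^ 2 * (A * (m * n')) := by ring
        _ ≤ m ^ 2 * M := by gcongr
    linarith
  have hA2 : 1 ≤ A ^ 2 := one_le_pow₀ hA
  refine max_le (by nlinarith) ?_
  calc A * (m * n) ≤ A * (A * m ^ 2) := by gcongr
    _ ≤ A * (A * (2 * M)) := by gcongr
    _ = 2 * A ^ 2 * M := by ring

end Archimedean

section HeightBounds

variable {a : ℤ}

theorem le_log_add_of_exp_le_mul_exp {x y c : ℝ} (hc : 0 < c)
    (h : Real.exp x ≤ c * Real.exp y) : x ≤ Real.log c + y := by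
  rwa [← Real.exp_le_exp, Real.exp_add, Real.exp_log hc]

theorem one_le_cast_sq (ha : a ≠ 0) : (1 : ℝ) ≤ (a : ℝ) ^ 2 := by
  exact_mod_cast (sq_pos_of_ne_zero ha : 0 < a ^ 2)

theorem HasIsogenyCoord.exp_scaledHeight_two_smul {n m : ℤ} {P : (E a).Point}
    (h : HasIsogenyCoord (n : ℚ) m P) (hnm : IsCoprime n m) {A : ℝ} (hA : 0 < A) :
    Real.exp (scaledHeight A (2 • P)) =
      max ((m : ℝ) ^ 2 - n * (a ^ 2 * m - n)) (A * (m * n)) := by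
  have h₁ : (0 : ℝ) ≤ (m : ℝ) ^ 2 - n * (a ^ 2 * m - n) := mod_cast h.sq_sub_mul_nonneg
  have h₂ : (0 : ℝ) ≤ (m : ℝ) * n := mod_cast h.mul_nonneg
  have hx : HasXCoord ((m ^ 2 - n * (a ^ 2 * m - n) : ℤ) : ℚ) ((m * n : ℤ) : ℚ) (2 • P) := by
    exact_mod_cast h.two_smul
  rw [hx.exp_scaledHeight (isCoprime_sq_sub_mul hnm) hA]
  push_cast
  rw [abs_of_nonneg h₁, abs_of_nonneg h₂]

theorem exists_isCoprime_hasIsogenyCoord (ha : a ≠ 0) {r s : ℤ} {P : (E a).Point}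
    (h : HasXCoord (r : ℚ) s P) (hrs : IsCoprime r s) :
    ∃ k n m : ℤ, k ≠ 0 ∧ |k| ≤ 12 * a ^ 4 ∧ IsCoprime n m ∧ HasIsogenyCoord (n : ℚ) m P ∧
      k * n = r ^ 2 + 2 * a ^ 2 * r * s + (a ^ 4 - 4) * s ^ 2 ∧ k * m = 4 * r * s := by
  obtain ⟨k, n, m, hkb, hnm, hn, hm⟩ := exists_isCoprime_quadratic hrs (a ^ 4 - 4) (2 * a ^ 2)
  have hb : 4 * (a ^ 4 - 4) ≠ 0 := mul_ne_zero four_ne_zero (mod_cast four_ne a)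
  have hk : k ≠ 0 := ne_zero_of_dvd_ne_zero hb hkb
  refine ⟨k, n, m, hk, ?_, hnm, ⟨r, s, k, h, mod_cast hk, mod_cast hn, mod_cast hm⟩, hn, hm⟩
  have ha4 : 0 < a ^ 4 := Even.pow_pos (by decide) ha
  calc |k| ≤ |4 * (a ^ 4 - 4)| :=
        Int.le_of_dvd (abs_pos.mpr hb) ((abs_dvd_abs k _).mpr hkb)
    _ = 4 * |a ^ 4 - 4| := by rw [abs_mul]; rfl
    _ ≤ 4 * (3 * a ^ 4) := by gcongr; exact abs_le.mpr ⟨by lia, by lia⟩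
    _ = 12 * a ^ 4 := by ring

/-- The factor `κ` is the square of the common divisor of the two forms defining the
`2`-isogeny: the second half of the duplication map creates no further common divisor. -/
theorem exists_mul_exp_scaledHeight_two_smul (ha : a ≠ 0) {r s : ℤ} {P : (E a).Point}
    (h : HasXCoord (r : ℚ) s P) (hrs : IsCoprime r s) :
    ∃ κ : ℝ, 1 ≤ κ ∧ κ ≤ 144 * (a : ℝ) ^ 8 ∧
      κ * Real.exp (scaledHeight ((a : ℝ) ^ 2) (2 • P)) =
        max (((r : ℝ) ^ 2 - (a ^ 4 - 4) * s ^ 2) ^ 2)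
          (4 * (r : ℝ) * (a ^ 2 * s) *
            ((r : ℝ) ^ 2 + 2 * r * (a ^ 2 * s) + (a ^ 4 - 4) * s ^ 2)) := by
  obtain ⟨k, n, m, hk, hk_le, hnm, hP, hn, hm⟩ := exists_isCoprime_hasIsogenyCoord ha h hrs
  have hn : (k : ℝ) * n = r ^ 2 + 2 * a ^ 2 * r * s + (a ^ 4 - 4) * s ^ 2 := mod_cast hn
  have hm : (k : ℝ) * m = 4 * r * s := mod_cast hm
  refine ⟨(k : ℝ) ^ 2, one_le_cast_sq hk, ?_, ?_⟩
  · have hk_le : |(k : ℝ)| ≤ 12 * (a : ℝ) ^ 4 := mod_cast hk_le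
    calc (k : ℝ) ^ 2 = |(k : ℝ)| ^ 2 := (sq_abs _).symm
      _ ≤ (12 * (a : ℝ) ^ 4) ^ 2 := by gcongr
      _ = 144 * (a : ℝ) ^ 8 := by ring
  · have hA : (0 : ℝ) < (a : ℝ) ^ 2 := by positivity
    rw [hP.exp_scaledHeight_two_smul hnm hA, mul_max_of_nonneg _ _ (sq_nonneg _)]
    congr 1
    · calc (k : ℝ) ^ 2 * (m ^ 2 - n * (a ^ 2 * m - n))
          = (k * m) ^ 2 - k * n * (a ^ 2 * (k * m) - k * n) := by ring
        _ = _ := by rw [hn, hm]; ring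
    · calc (k : ℝ) ^ 2 * (a ^ 2 * (m * n)) = a ^ 2 * (k * m) * (k * n) := by ring
        _ = _ := by rw [hn, hm]; ring

theorem quartic_mul_sq_bounds (ha : a ≠ 0) (s : ℝ) :
    -3 * (a ^ 2 * s) ^ 2 ≤ ((a : ℝ) ^ 4 - 4) * s ^ 2 ∧
      (((a : ℝ) ^ 4 - 4) * s ^ 2 ≤ -(a ^ 2 * s) ^ 2 ∨
        3 / 4 * (a ^ 2 * s) ^ 2 ≤ ((a : ℝ) ^ 4 - 4) * s ^ 2) := by
  have hS : ((a : ℝ) ^ 2 * s) ^ 2 = (a : ℝ) ^ 4 * s ^ 2 := by ring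
  have h₁ : (1 : ℝ) ≤ (a : ℝ) ^ 4 := by
    simpa only [← pow_mul] using one_le_pow₀ (one_le_cast_sq ha) (n := 2)
  have h₁₆ : (a : ℝ) ^ 4 = 1 ∨ (16 : ℝ) ≤ (a : ℝ) ^ 4 := by
    rcases (Int.one_le_abs ha).eq_or_lt with h | h
    · left
      rw [← Even.pow_abs (by decide), ← Int.cast_abs, ← h]
      norm_num
    · right
      have h₂ : (2 : ℝ) ≤ |(a : ℝ)| := mod_cast h
      calc (16 : ℝ) = 2 ^ 4 := by norm_num
        _ ≤ |(a : ℝ)| ^ 4 := by gcongr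
        _ = (a : ℝ) ^ 4 := Even.pow_abs (by decide) _
  rw [hS]
  refine ⟨by nlinarith [sq_nonneg s], h₁₆.imp (fun h => ?_) fun h => ?_⟩
  · rw [h]
    linarith [sq_nonneg s]
  · nlinarith [sq_nonneg s]

theorem scaledHeight_two_smul_bounds (ha : a ≠ 0) {r s : ℤ} {P : (E a).Point}
    (h : HasXCoord (r : ℚ) s P) (hrs : IsCoprime r s) (hr : 0 ≤ r) (hs : 0 ≤ s) :
    scaledHeight ((a : ℝ) ^ 2) (2 • P) ≤ Real.log 16 + 4 * scaledHeight ((a : ℝ) ^ 2) P ∧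
      4 * scaledHeight ((a : ℝ) ^ 2) P ≤
        Real.log (576 * (a : ℝ) ^ 8) + scaledHeight ((a : ℝ) ^ 2) (2 • P) := by
  obtain ⟨κ, hκ, hκ_le, heq⟩ := exists_mul_exp_scaledHeight_two_smul ha h hrs
  obtain ⟨hBl, hB⟩ := quartic_mul_sq_bounds ha (s : ℝ)
  have hBu : ((a : ℝ) ^ 4 - 4) * s ^ 2 ≤ (a ^ 2 * s) ^ 2 := by
    linarith [sq_nonneg (s : ℝ)]
  have hr : (0 : ℝ) ≤ r := mod_cast hr
  have hs : (0 : ℝ) ≤ s := mod_cast hs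
  have hS : (0 : ℝ) ≤ a ^ 2 * s := by positivity
  have hP : Real.exp (scaledHeight ((a : ℝ) ^ 2) P) = max (r : ℝ) (a ^ 2 * s) := by
    rw [h.exp_scaledHeight hrs (by positivity), abs_of_nonneg hr, abs_of_nonneg hs]
  have hupper := max_duplication_le hr hS hBl hBu
  have hlower := max_pow_four_le_max_duplication hr hS (hB.imp_right fun h => ⟨h, hBu⟩)
  rw [← heq, ← hP, ← Real.exp_nat_mul, Nat.cast_ofNat] at hupper hlower
  constructor
  · exact le_log_add_of_exp_le_mul_exp (by norm_num)
      ((le_mul_of_one_le_left (Real.exp_nonneg _) hκ).trans hupper)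
  · refine le_log_add_of_exp_le_mul_exp (by positivity) (hlower.trans ?_)
    rw [← mul_assoc]
    exact mul_le_mul_of_nonneg_right (by linarith) (Real.exp_nonneg _)

theorem scaledHeight_two_smul_le_of_x_mul_x_eq (ha : a ≠ 0) {x₁ y₁ x₂ y₂ : ℚ}
    (h₁ : (E a).Nonsingular x₁ y₁) (h₂ : (E a).Nonsingular x₂ y₂)
    (hx : x₁ * x₂ = -((a : ℚ) ^ 4 - 4)) :
    scaledHeight ((a : ℝ) ^ 2) (2 • Point.some x₁ y₁ h₁) ≤
      Real.log (2 * (a : ℝ) ^ 4) + scaledHeight ((a : ℝ) ^ 2) (2 • Point.some x₂ y₂ h₂) := by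
  obtain ⟨r, s, hrs, hP⟩ := exists_isCoprime_hasXCoord (Point.some x₁ y₁ h₁)
  obtain ⟨-, n, m, -, -, hnm, hn, -, -⟩ := exists_isCoprime_hasIsogenyCoord ha hP hrs
  have hn' : HasIsogenyCoord ((a ^ 2 * m - n : ℤ) : ℚ) m (.some x₂ y₂ h₂) := by
    exact_mod_cast hn.of_x_mul_x_eq hx
  have hnm' : IsCoprime (a ^ 2 * m - n) m := by
    rw [sub_eq_neg_add, mul_comm]
    exact hnm.neg_left.add_mul_left_left _
  have hA : (0 : ℝ) < (a : ℝ) ^ 2 := by positivity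
  have hcompare := max_isogeny_le (n := n) (n' := a ^ 2 * m - n) (m := m) (one_le_cast_sq ha)
    (mod_cast hn.mul_nonneg) (mod_cast hn'.mul_nonneg) (by ring) (mod_cast hn.sq_sub_mul_nonneg)
  apply le_log_add_of_exp_le_mul_exp (by positivity)
  rw [hn.exp_scaledHeight_two_smul hnm hA, hn'.exp_scaledHeight_two_smul hnm' hA]
  push_cast
  convert hcompare using 2 <;> ring_nf

end HeightBounds

section CanonicalHeight

variable {a : ℤ}

theorem le_of_tendsto_div_pow {d C L : ℝ} {u : ℕ → ℝ} (hd : 1 < d)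
    (hu : ∀ n, u (n + 1) ≤ d * u n + C) (hL : Tendsto (fun n => u n / d ^ n) atTop (𝓝 L)) :
    L ≤ u 0 + C / (d - 1) := by
  have hd₁ : d - 1 ≠ 0 := by linarith
  have hC : C = d * (C / (d - 1)) - C / (d - 1) := by field_simp
  have hbound (n : ℕ) : u n + C / (d - 1) ≤ d ^ n * (u 0 + C / (d - 1)) := by
    induction n with
    | zero => simp
    | succ n ih =>
      calc u (n + 1) + C / (d - 1) ≤ d * (u n + C / (d - 1)) := by linarith [hu n]
        _ ≤ d * (d ^ n * (u 0 + C / (d - 1))) := by gcongr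
        _ = d ^ (n + 1) * (u 0 + C / (d - 1)) := by ring
  have hzero : Tendsto (fun n => C / (d - 1) / d ^ n) atTop (𝓝 0) :=
    tendsto_const_nhds.div_atTop (tendsto_pow_atTop_atTop_of_one_lt hd)
  refine le_of_tendsto' (by simpa using hL.add hzero) fun n => ?_
  rw [← add_div, div_le_iff₀' (by positivity)]
  exact hbound n

theorem tendsto_scaledHeight {A : ℝ} (hA : 1 ≤ A) (P : (E a).Point) :
    Tendsto (fun n : ℕ => scaledHeight A (2 ^ n • P) / (4 : ℝ) ^ n) atTop
      (𝓝 (canonicalHeight P)) := by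
  have hlog : Tendsto (fun n : ℕ => Real.log A / (4 : ℝ) ^ n) atTop (𝓝 0) :=
    tendsto_const_nhds.div_atTop (tendsto_pow_atTop_atTop_of_one_lt (by norm_num))
  have hdiff : Tendsto (fun n : ℕ => scaledHeight A (2 ^ n • P) / (4 : ℝ) ^ n
      - naiveHeight (2 ^ n • P) / (4 : ℝ) ^ n) atTop (𝓝 0) := by
    refine squeeze_zero_norm (fun n => ?_) hlog
    rw [← sub_div, norm_div, Real.norm_eq_abs, norm_pow, Real.norm_ofNat]
    gcongr
    exact abs_scaledHeight_sub_naiveHeight_le hA _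
  simpa using hdiff.add (tendsto_canonicalHeight P)

theorem canonicalHeight_two_smul (P : (E a).Point) :
    canonicalHeight (2 • P) = 4 * canonicalHeight P := by
  have hshift := ((tendsto_canonicalHeight P).comp (tendsto_add_atTop_nat 1)).const_mul 4
  refine tendsto_nhds_unique (tendsto_canonicalHeight (2 • P)) (hshift.congr fun n => ?_)
  simp only [Function.comp_apply, smul_smul, ← pow_succ]
  field_simp
  ring

/-- Doubling makes the `x`-coordinate a square, hence nonnegative, which is what
`scaledHeight_two_smul_bounds` requires. -/
theorem scaledHeight_four_smul_bounds (ha : a ≠ 0) (P : (E a).Point) :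
    scaledHeight ((a : ℝ) ^ 2) (2 • 2 • P) ≤
        4 * scaledHeight ((a : ℝ) ^ 2) (2 • P) + Real.log 16 ∧
      4 * scaledHeight ((a : ℝ) ^ 2) (2 • P) ≤
        scaledHeight ((a : ℝ) ^ 2) (2 • 2 • P) + Real.log (576 * (a : ℝ) ^ 8) := by
  obtain ⟨r, s, hrs, hP⟩ := exists_isCoprime_hasXCoord P
  obtain ⟨-, n, m, -, -, hnm, hn, -, -⟩ := exists_isCoprime_hasIsogenyCoord ha hP hrs
  have h := scaledHeight_two_smul_bounds ha (mod_cast hn.two_smul) (isCoprime_sq_sub_mul hnm)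
    (mod_cast hn.sq_sub_mul_nonneg) (mod_cast hn.mul_nonneg)
  exact ⟨by linarith [h.1], by linarith [h.2]⟩

theorem canonicalHeight_two_smul_bounds (ha : a ≠ 0) (P : (E a).Point) :
    canonicalHeight (2 • P) ≤ scaledHeight ((a : ℝ) ^ 2) (2 • P) + Real.log 16 / 3 ∧
      scaledHeight ((a : ℝ) ^ 2) (2 • P) ≤
        canonicalHeight (2 • P) + Real.log (576 * (a : ℝ) ^ 8) / 3 := by
  have hstep (n : ℕ) := scaledHeight_four_smul_bounds ha (2 ^ n • P)
  have hcomm (n : ℕ) : 2 • 2 ^ n • P = 2 ^ n • 2 • P := smul_comm ..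
  have hlim := tendsto_scaledHeight (one_le_cast_sq ha) (2 • P)
  simp only [hcomm, smul_smul 2 (2 ^ _) (2 • P), ← pow_succ'] at hstep
  have hupper := le_of_tendsto_div_pow (by norm_num) (fun n => (hstep n).1) hlim
  have hlower := le_of_tendsto_div_pow (d := 4) (C := Real.log (576 * (a : ℝ) ^ 8))
    (u := fun n => -scaledHeight ((a : ℝ) ^ 2) (2 ^ n • 2 • P)) (by norm_num)
    (fun n => by linarith [(hstep n).2])
    (by simpa only [neg_div] using hlim.neg)
  norm_num at hupper hlower
  exact ⟨hupper, by linarith⟩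

theorem canonicalHeight_sub_le_of_x_mul_x_eq (ha : a ≠ 0) {x₁ y₁ x₂ y₂ : ℚ}
    (h₁ : (E a).Nonsingular x₁ y₁) (h₂ : (E a).Nonsingular x₂ y₂)
    (hx : x₁ * x₂ = -((a : ℚ) ^ 4 - 4)) :
    canonicalHeight (Point.some x₁ y₁ h₁) - canonicalHeight (Point.some x₂ y₂ h₂) ≤
      1 + 5 / 3 * Real.log |(a : ℝ)| := by
  have hcompare := scaledHeight_two_smul_le_of_x_mul_x_eq ha h₁ h₂ hx
  have hupper := (canonicalHeight_two_smul_bounds ha (Point.some x₁ y₁ h₁)).1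
  have hlower := (canonicalHeight_two_smul_bounds ha (Point.some x₂ y₂ h₂)).2
  rw [canonicalHeight_two_smul] at hupper hlower
  have ha' : (a : ℝ) ≠ 0 := mod_cast ha
  rw [Real.log_mul (by norm_num) (by positivity), Real.log_pow, ← Real.log_abs (a : ℝ)]
    at hcompare hlower
  have hconst : Real.log 2 + Real.log 16 / 3 + Real.log 576 / 3 ≤ 4 := by
    have h16 : Real.log 16 = 4 * Real.log 2 := by
      rw [← Real.log_rpow two_pos]
      norm_num
    have h576 : Real.log 576 ≤ 10 * Real.log 2 := by
      rw [← Real.log_rpow two_pos]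
      exact Real.log_le_log (by norm_num) (by norm_num)
    linarith [Real.log_two_lt_d9]
  push_cast at hcompare hlower
  linarith

theorem phi1X_mul_phi2X (p : CurveCoords a) :
    phi1X a p.X p.Y p.Z / phiZ p.X p.Z * (phi2X a p.X p.Y p.Z / phiZ p.X p.Z)
      = -((a : ℚ) ^ 4 - 4) := by
  have hZ := phiZ_ne p
  have hcurve := p.equation
  unfold octic at hcurve
  field_simp
  unfold phi1X phi2X phiZ
  linear_combination (4 * (p.X ^ 2 + p.Z ^ 2) ^ 2) * hcurve

end CanonicalHeight

end DemyanenkoManin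

theorem mainTheorem4_general (a : ℤ) (ha : a ≠ 0) (P : DemyanenkoManin.Curve a) :
    |DemyanenkoManin.canonicalHeight (DemyanenkoManin.phi1 P)
        - DemyanenkoManin.canonicalHeight (DemyanenkoManin.phi2 P)|
      ≤ 1 + 5 / 3 * Real.log |(a : ℝ)| := by
  induction P using Quotient.inductionOn with
  | h p =>
    have hx := DemyanenkoManin.phi1X_mul_phi2X p
    exact abs_sub_le_iff.mpr
      ⟨DemyanenkoManin.canonicalHeight_sub_le_of_x_mul_x_eq ha _ _ hx,
        DemyanenkoManin.canonicalHeight_sub_le_of_x_mul_x_eq ha _ _ ((mul_comm _ _).trans hx)⟩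

theorem mainTheorem4 (a : ℤ) (ha : a ≠ 0) (P : DemyanenkoManin.Curve a) :
    |DemyanenkoManin.canonicalHeight (DemyanenkoManin.phi1 P)
        - DemyanenkoManin.canonicalHeight (DemyanenkoManin.phi2 P)|
      ≤ 51.18 + 2 * Real.log |(a : ℝ)| := by
  have hlog : 0 ≤ Real.log |(a : ℝ)| := Real.log_nonneg (mod_cast Int.one_le_abs ha)
  linarith [mainTheorem4_general a ha P]
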